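/- Let $p$ be a prime number, let $\mathbb{C}_p$ be the completion of an algebraic closure of $\mathbb{Q}_p$, and let $\mathfrak{m}_{\mathbb{C}_p}$ be its open unit disk. For a ring $R$ let $S_0(R)$ denote the set of formal power series over $R$ without constant term, a monoid under composition. Let $f, u \in S_0(\mathbb{Z}_p)$ be such that - $f\circ u = u\circ f$; - $u$ is invertible in $S_0(\mathbb{Z}_p)$ and has infinite order under composition; - $v_p(f'(0)) = 1$ and $f$ has exactly $p$ roots in $\mathfrak{m}_{\mathbb{C}_p}$. Let $\log_f \in S_0(\mathbb{Q}_p)$ be the logarithm of the pair $(f,u)$, i.e. the unique power series over $\mathbb{Q}_p$ without constant term such that $\log_f'(0) = 1$ and $\log_f(f(x)) = f'(0)\,\log_f(x)$. Then the derivative $\log_f'$ has all its coefficients in $\mathbb{Z}_p$, that is, $\log_f' \in \mathbb{Z}_p[[x]]$. -/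

import Mathlib

open PowerSeries

/-- The `n`-th compositional iterate `u ∘ u ∘ ⋯ ∘ u` of a power series (`X` for `n = 0`). It is
used for series without constant term only. -/
noncomputable def compIter {R : Type*} [CommRing R] (u : R⟦X⟧) : ℕ → R⟦X⟧
  | 0 => X
  | n + 1 => u.subst (compIter u n)

/-- `u` is invertible for composition in the monoid of power series without constant term. -/
def CompInvertible {R : Type*} [CommRing R] (u : R⟦X⟧) : Prop :=
  ∃ w : R⟦X⟧, constantCoeff w = 0 ∧ u.subst w = X ∧ w.subst u = X

/-- `u` has infinite order for composition: no positive iterate is the identity. -/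
def CompInfiniteOrder {R : Type*} [CommRing R] (u : R⟦X⟧) : Prop :=
  ∀ n : ℕ, 0 < n → compIter u n ≠ X

/-- The value `f(x)` at `x ∈ ℂ_p` of a power series over `ℤ_p`; the sum converges for `‖x‖ < 1`. -/
noncomputable def evalCp (p : ℕ) [Fact p.Prime] (f : ℤ_[p]⟦X⟧) (x : ℂ_[p]) : ℂ_[p] :=
  ∑' n : ℕ, algebraMap ℚ_[p] ℂ_[p] ((coeff n f : ℤ_[p]) : ℚ_[p]) * x ^ n

/-- The set of roots of `f` in the open unit disk of `ℂ_p`. -/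
def rootsInDisk (p : ℕ) [Fact p.Prime] (f : ℤ_[p]⟦X⟧) : Set ℂ_[p] :=
  {x | ‖x‖ < 1 ∧ evalCp p f x = 0}

/-- `L ∈ ℚ_p⟦X⟧` has no constant term, `L'(0) = 1` and `L(f(X)) = f'(0) L(X)`. -/
structure IsLubinLog (p : ℕ) [Fact p.Prime] (f : ℤ_[p]⟦X⟧) (L : ℚ_[p]⟦X⟧) : Prop where
  constantCoeff_eq_zero : constantCoeff L = 0
  deriv_zero : constantCoeff (derivative ℚ_[p] L) = 1
  subst_eq : L.subst (f.map (algebraMap ℤ_[p] ℚ_[p])) =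
    C ((constantCoeff (derivative ℤ_[p] f) : ℤ_[p]) : ℚ_[p]) * L

open Classical in
/-- Lubin's logarithm `log_f`: the series `L` without constant term such that `L'(0) = 1` and
`L ∘ f = f'(0) L`. It exists and is unique when `f(0) = 0` and `f'(0)` is neither zero nor a root
of unity, see `existsUnique_isLubinLog`. -/
noncomputable def lubinLog (p : ℕ) [Fact p.Prime] (f : ℤ_[p]⟦X⟧) : ℚ_[p]⟦X⟧ :=
  if h : ∃ L, IsLubinLog p f L then h.choose else 0

theorem coeff_pow_self_of_constantCoeff {K : Type*} [CommRing K] {φ : K⟦X⟧}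
    (h0 : constantCoeff φ = 0) (n : ℕ) : coeff n (φ ^ n) = coeff 1 φ ^ n := by
  obtain ⟨ψ, rfl⟩ := X_dvd_iff.mpr h0
  have h1 : coeff 1 (X * ψ) = constantCoeff ψ := by
    simp
  rw [h1, mul_pow, coeff_X_pow_mul', if_pos le_rfl, Nat.sub_self, coeff_zero_eq_constantCoeff,
    map_pow]

theorem coeff_subst_eq_sum {K : Type*} [CommRing K] {φ : K⟦X⟧}
    (h0 : constantCoeff φ = 0) (L : K⟦X⟧) (n : ℕ) :
    coeff n (L.subst φ) =
      (∑ k ∈ Finset.range n, coeff k L * coeff n (φ ^ k)) + coeff n L * coeff 1 φ ^ n := by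
  rw [coeff_subst' (HasSubst.of_constantCoeff_zero' h0),
    finsum_eq_sum_of_support_subset (s := Finset.range (n + 1)), Finset.sum_range_succ,
    coeff_pow_self_of_constantCoeff h0]
  · simp
  · intro k hk
    by_contra hkn
    simp only [Finset.coe_range, Set.mem_Iio, not_lt] at hkn
    apply hk
    obtain ⟨ψ, rfl⟩ := X_dvd_iff.mpr h0
    simp only [mul_pow, coeff_X_pow_mul', smul_eq_mul]
    rw [if_neg (by omega), mul_zero]

theorem existsUnique_semiconj {K : Type*} [Field K] {φ : K⟦X⟧}
    (h0 : constantCoeff φ = 0) (ha : coeff 1 φ ≠ 0) (hu : ∀ n : ℕ, 0 < n → coeff 1 φ ^ n ≠ 1) :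
    ∃! L : K⟦X⟧, constantCoeff L = 0 ∧ coeff 1 L = 1 ∧ L.subst φ = C (coeff 1 φ) * L := by
  set a := coeff 1 φ with ha_def
  have hne : ∀ n : ℕ, 2 ≤ n → a - a ^ n ≠ 0 := by
    intro n hn h
    obtain ⟨m, rfl⟩ : ∃ m, n = m + 1 := ⟨n - 1, by omega⟩
    refine hu m (by omega) (mul_left_cancel₀ ha ?_)
    rw [mul_one, ← pow_succ']
    exact (sub_eq_zero.mp h).symm
  let l : ℕ → K := fun n => Nat.strongRec (motive := fun _ => K) (fun n ih =>
    if n = 0 then 0 else if n = 1 then 1 else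
      (∑ k : Fin n, ih k k.2 * coeff n (φ ^ (k : ℕ))) / (a - a ^ n)) n
  have hl : ∀ n, l n = if n = 0 then 0 else if n = 1 then 1 else
      (∑ k : Fin n, l k * coeff n (φ ^ (k : ℕ))) / (a - a ^ n) := by
    intro n
    simp only [l]
    rw [Nat.strongRec]
  refine ⟨PowerSeries.mk l, ⟨?_, ?_, ?_⟩, ?_⟩
  · rw [← coeff_zero_eq_constantCoeff_apply, coeff_mk, hl]; simp
  · rw [coeff_mk, hl]; simp
  · ext n
    rw [coeff_subst_eq_sum h0, coeff_C_mul]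
    simp only [coeff_mk]
    rcases Nat.lt_or_ge n 2 with h | h
    · interval_cases n
      · simp [hl 0]
      · simp [hl 0, hl 1, ← ha_def]
    · have h1 := hl n
      rw [if_neg (by omega), if_neg (by omega), eq_div_iff (hne n h),
        Fin.sum_univ_eq_sum_range (fun k => l k * coeff n (φ ^ k)) n] at h1
      rw [← h1, ← ha_def]
      ring
  · rintro L ⟨hL0, hL1, hL⟩
    ext n
    rw [coeff_mk]
    induction n using Nat.strong_induction_on with
    | _ n ih =>
      rcases Nat.lt_or_ge n 2 with h | h
      · interval_cases n
        · simp [hl 0, hL0]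
        · simp [hl 1, hL1]
      · have h1 := hl n
        rw [if_neg (by omega), if_neg (by omega), eq_div_iff (hne n h),
          Fin.sum_univ_eq_sum_range (fun k => l k * coeff n (φ ^ k)) n] at h1
        have h2 := congrArg (coeff n) hL
        rw [coeff_subst_eq_sum h0, coeff_C_mul, ← ha_def,
          Finset.sum_congr rfl (fun k hk => by rw [ih k (Finset.mem_range.mp hk)]), ← h1] at h2
        refine mul_right_cancel₀ (hne n h) ?_
        linear_combination -h2

theorem existsUnique_isLubinLog (p : ℕ) [Fact p.Prime] (f : ℤ_[p]⟦X⟧)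
    (h0 : constantCoeff f = 0) (ha : coeff 1 f ≠ 0) (hu : ∀ n : ℕ, 0 < n → coeff 1 f ^ n ≠ 1) :
    ∃! L, IsLubinLog p f L := by
  have key := existsUnique_semiconj (φ := f.map (algebraMap ℤ_[p] ℚ_[p]))
    (by rw [← coeff_zero_eq_constantCoeff_apply, coeff_map, coeff_zero_eq_constantCoeff_apply,
      h0, map_zero])
    (by rw [coeff_map]; exact fun h => ha (Subtype.ext h))
    (by
      intro n hn h
      rw [coeff_map, ← map_pow] at h
      exact hu n hn (Subtype.ext h))
  have hiff : ∀ L, IsLubinLog p f L ↔ (constantCoeff L = 0 ∧ coeff 1 L = 1 ∧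
      L.subst (f.map (algebraMap ℤ_[p] ℚ_[p])) =
        C (coeff 1 (f.map (algebraMap ℤ_[p] ℚ_[p]))) * L) := by
    have hd : ∀ {R : Type} [CommRing R] (g : R⟦X⟧),
        constantCoeff (derivative R g) = coeff 1 g := by
      intro R _ g
      rw [← coeff_zero_eq_constantCoeff_apply, coeff_derivative]
      simp
    intro L
    constructor
    · rintro ⟨h1, h2, h3⟩
      refine ⟨h1, by rwa [hd] at h2, ?_⟩
      rw [h3, hd, coeff_map]
      rfl
    · rintro ⟨h1, h2, h3⟩
      refine ⟨h1, by rwa [hd], ?_⟩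
      rw [h3, hd, coeff_map]
      rfl
  simpa only [hiff] using key

theorem isLubinLog_lubinLog (p : ℕ) [Fact p.Prime] (f : ℤ_[p]⟦X⟧)
    (h0 : constantCoeff f = 0) (ha : coeff 1 f ≠ 0) (hu : ∀ n : ℕ, 0 < n → coeff 1 f ^ n ≠ 1) :
    IsLubinLog p f (lubinLog p f) := by
  have h : ∃ L, IsLubinLog p f L := (existsUnique_isLubinLog p f h0 ha hu).exists
  rw [lubinLog, dif_pos h]
  exact h.choose_spec

/-! ### Composition of power series without constant term. -/

section Composition

variable {R : Type*} [CommRing R]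

/-! The crux is that `p ∣ f'` (`C_dvd_derivative`). Then `g = f' / f'(0)` is integral, and
differentiating `L ∘ f = f'(0) L` gives `L' = (L' ∘ f) g`. Comparing `n`-th coefficients determines
that of `L'` from the earlier ones, up to division by the unit `1 - f'(0)^n`
(`exists_map_eq_of_subst_mul`).

Suppose `p ∤ f'`. Some prime `Q` of `ℤ_p⟦X⟧` contains `f'` but not `p`; the class of `X` modulo `Q`
serves as a zero of `f'` in the open disk. By Weierstrass preparation a nonzero series has finitely
many zeros modulo `Q`. Iterates of `u` send this zero to zeros of `f'`, so some iterate `w ≠ X` of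
`u` fixes it. Iterates of `f` send it to zeros of `w - X`, so two of them agree modulo `Q`; as the
later is the earlier times some `s` with `1 - s` a unit, the earlier lies in `Q`. Hence the point is
a zero of an iterate of `f`. At the first such iterate the zero is simple, by Eisenstein and
separability, whereas the chain rule makes `f'` divide the derivative of that iterate: a
contradiction. -/

theorem constantCoeff_subst_of_constantCoeff_zero {g h : R⟦X⟧} (hh : constantCoeff h = 0) :
    constantCoeff (g.subst h) = constantCoeff g := by
  rw [← coeff_zero_eq_constantCoeff_apply, coeff_subst_eq_sum hh]
  simp

theorem constantCoeff_compIter {u : R⟦X⟧} (hu : constantCoeff u = 0) (n : ℕ) :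
    constantCoeff (compIter u n) = 0 := by
  induction n with
  | zero => simp [compIter]
  | succ n ih => rw [compIter, constantCoeff_subst_of_constantCoeff_zero ih, hu]

theorem hasSubst_compIter {u : R⟦X⟧} (hu : constantCoeff u = 0) (n : ℕ) :
    HasSubst (compIter u n) :=
  HasSubst.of_constantCoeff_zero' (constantCoeff_compIter hu n)

theorem compIter_one (u : R⟦X⟧) : compIter u 1 = u := by
  simp only [compIter]
  exact X_subst u

theorem compIter_add {u : R⟦X⟧} (hu : constantCoeff u = 0) (m n : ℕ) :
    compIter u (m + n) = (compIter u m).subst (compIter u n) := by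
  induction m with
  | zero => rw [Nat.zero_add, compIter, subst_X (hasSubst_compIter hu n)]
  | succ m ih =>
    rw [Nat.add_right_comm, compIter, ih, compIter,
      subst_comp_subst_apply (hasSubst_compIter hu m) (hasSubst_compIter hu n)]

theorem subst_compIter_comm {f u : R⟦X⟧} (hf : constantCoeff f = 0) (hu : constantCoeff u = 0)
    (h : f.subst u = u.subst f) (n : ℕ) :
    f.subst (compIter u n) = (compIter u n).subst f := by
  have hf' := HasSubst.of_constantCoeff_zero' hf
  have hu' := HasSubst.of_constantCoeff_zero' hu
  induction n with
  | zero => rw [compIter, subst_X hf']; exact X_subst f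
  | succ n ih =>
    have h1 := hasSubst_compIter hu n
    rw [compIter, ← subst_comp_subst_apply hu' h1, h, subst_comp_subst_apply hf' h1, ih,
      subst_comp_subst_apply h1 hf']

theorem compIter_subst_compIter {u v : R⟦X⟧} (hu : constantCoeff u = 0)
    (hv : constantCoeff v = 0) (h : v.subst u = X) (n : ℕ) :
    (compIter v n).subst (compIter u n) = X := by
  have hu' := HasSubst.of_constantCoeff_zero' hu
  have hv' := HasSubst.of_constantCoeff_zero' hv
  induction n with
  | zero => simp only [compIter]; exact X_subst _
  | succ n ih =>
    have h1 := hasSubst_compIter hu n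
    -- Expose the innermost `v` and the outermost `u`, which cancel.
    rw [compIter_add hv, compIter_one, compIter,
      subst_comp_subst_apply hv' (HasSubst.of_constantCoeff_zero'
        (by rw [constantCoeff_subst_of_constantCoeff_zero (constantCoeff_compIter hu n), hu])),
      ← subst_comp_subst_apply hu' h1, h, subst_X h1, ih]

theorem isUnit_derivative_of_subst_eq_X {u v : R⟦X⟧} (hu : constantCoeff u = 0)
    (h : v.subst u = X) : IsUnit (derivative R u) := by
  have h1 := derivative_subst (f := v) (HasSubst.of_constantCoeff_zero' hu)
  rw [h, derivative_X] at h1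
  exact IsUnit.of_mul_eq_one_right _ h1.symm

theorem constantCoeff_derivative (g : R⟦X⟧) :
    constantCoeff (derivative R g) = coeff 1 g := by
  rw [← coeff_zero_eq_constantCoeff_apply, coeff_derivative]
  simp

theorem coeff_subst_eq_sum_of_lt {h : R⟦X⟧} (hh : constantCoeff h = 0) (g : R⟦X⟧) {n N : ℕ}
    (hn : n < N) : coeff n (g.subst h) = ∑ k ∈ Finset.range N, coeff k g * coeff n (h ^ k) := by
  rw [coeff_subst' (HasSubst.of_constantCoeff_zero' hh)]
  refine finsum_eq_sum_of_support_subset _ fun k hk => ?_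
  by_contra hkN
  simp only [Finset.coe_range, Set.mem_Iio, not_lt] at hkN
  apply hk
  obtain ⟨ψ, rfl⟩ := X_dvd_iff.mpr hh
  simp only [mul_pow, coeff_X_pow_mul', smul_eq_mul]
  rw [if_neg (by omega), mul_zero]

/-- Sum the factorizations of `h₁ ^ n - h₂ ^ n`. Having an actual quotient lets congruences pass
through substitution modulo any ideal, with no topology. -/
theorem sub_dvd_subst_sub_subst {h₁ h₂ : R⟦X⟧} (h1 : constantCoeff h₁ = 0)
    (h2 : constantCoeff h₂ = 0) (g : R⟦X⟧) : h₁ - h₂ ∣ g.subst h₁ - g.subst h₂ := by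
  set c : ℕ → R⟦X⟧ := fun n => ∑ i ∈ Finset.range n, h₁ ^ i * h₂ ^ (n - 1 - i)
  have hcX : ∀ n, X ^ (n - 1) ∣ c n := fun n => by
    refine Finset.dvd_sum fun i hi => ?_
    rw [Finset.mem_range] at hi
    rw [show n - 1 = i + (n - 1 - i) by omega, pow_add, Nat.add_sub_cancel_left]
    exact mul_dvd_mul (pow_dvd_pow_of_dvd (X_dvd_iff.mpr h1) _)
      (pow_dvd_pow_of_dvd (X_dvd_iff.mpr h2) _)
  -- Since `X ^ (n - 1) ∣ c n`, only the terms `n ≤ j + 1` contribute to coefficient `j`.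
  refine ⟨PowerSeries.mk fun j => ∑ n ∈ Finset.range (j + 2), coeff n g * coeff j (c n), ?_⟩
  ext k
  have hr : ∀ j ≤ k, ∑ n ∈ Finset.range (j + 2), coeff n g * coeff j (c n) =
      coeff j (∑ n ∈ Finset.range (k + 2), C (coeff n g) * c n) := fun j hj => by
    simp only [map_sum, coeff_C_mul]
    refine Finset.sum_subset (Finset.range_mono (by omega)) fun n _ hn => ?_
    rw [Finset.mem_range, not_lt] at hn
    rw [X_pow_dvd_iff.mp (hcX n) j (by omega), mul_zero]
  have hmul : coeff k ((h₁ - h₂) * PowerSeries.mk fun j =>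
      ∑ n ∈ Finset.range (j + 2), coeff n g * coeff j (c n)) =
      coeff k ((h₁ - h₂) * ∑ n ∈ Finset.range (k + 2), C (coeff n g) * c n) := by
    rw [coeff_mul, coeff_mul]
    refine Finset.sum_congr rfl fun ij hij => ?_
    rw [Finset.HasAntidiagonal.mem_antidiagonal] at hij
    rw [coeff_mk, hr _ (by omega)]
  rw [hmul, map_sub, coeff_subst_eq_sum_of_lt h1 g (show k < k + 2 by omega),
    coeff_subst_eq_sum_of_lt h2 g (show k < k + 2 by omega), ← Finset.sum_sub_distrib,
    Finset.mul_sum, map_sum]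
  refine Finset.sum_congr rfl fun n _ => ?_
  rw [mul_left_comm, coeff_C_mul, mul_comm (h₁ - h₂), (Commute.all h₁ h₂).geom_sum₂_mul, map_sub,
    mul_sub]

theorem compIter_succ_eq_mul {f F : R⟦X⟧} (hf : constantCoeff f = 0) (hF : f = X * F) (n : ℕ) :
    compIter f (n + 1) = compIter f n * F.subst (compIter f n) := by
  have h1 := hasSubst_compIter hf n
  rw [compIter, congrArg (subst (compIter f n)) hF, subst_mul h1, subst_X h1]

theorem exists_compIter_add_eq_mul {f F : R⟦X⟧} (hf : constantCoeff f = 0) (hF : f = X * F)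
    (i k : ℕ) : ∃ s : R⟦X⟧, compIter f (i + k + 1) = compIter f i * s ∧
      constantCoeff F ∣ constantCoeff s := by
  induction k with
  | zero =>
    refine ⟨_, compIter_succ_eq_mul hf hF i, ?_⟩
    rw [constantCoeff_subst_of_constantCoeff_zero (constantCoeff_compIter hf i)]
  | succ k ih =>
    obtain ⟨s, hs, hd⟩ := ih
    refine ⟨s * F.subst (compIter f (i + k + 1)), ?_, ?_⟩
    · rw [← add_assoc, compIter_succ_eq_mul hf hF, hs, mul_assoc]
    · rw [map_mul]
      exact dvd_mul_of_dvd_left hd _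

end Composition

/-! ### Zeros of power series over `ℤ_p` modulo a prime ideal. -/

section PadicInt

variable {p : ℕ} [Fact p.Prime]

theorem PadicInt.map_residue_eq_zero_iff {g : ℤ_[p]⟦X⟧} :
    g.map (IsLocalRing.residue ℤ_[p]) = 0 ↔ C (p : ℤ_[p]) ∣ g := by
  have key : ∀ x : ℤ_[p], IsLocalRing.residue ℤ_[p] x = 0 ↔ (p : ℤ_[p]) ∣ x := fun x => by
    rw [IsLocalRing.residue_eq_zero_iff, PadicInt.maximalIdeal_eq_span_p,
      Ideal.mem_span_singleton]
  constructor
  · intro h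
    have h1 : ∀ n, ∃ c, coeff n g = p * c := fun n => by
      refine (key _).mp ?_
      rw [← coeff_map, h, map_zero]
    choose c hc using h1
    refine ⟨PowerSeries.mk c, ?_⟩
    ext n
    rw [coeff_C_mul, coeff_mk, hc]
  · rintro ⟨c, rfl⟩
    ext n
    rw [coeff_map, coeff_C_mul, map_zero, (key _).mpr (dvd_mul_right _ _)]

/-- The reduction modulo `p` takes values in a domain, power series over the residue field. -/
theorem PadicInt.prime_powerSeries_C : Prime (C (p : ℤ_[p]) : ℤ_[p]⟦X⟧) := by
  refine ⟨fun h => ?_, fun h => ?_, fun a b h => ?_⟩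
  · have h1 := congrArg constantCoeff h
    rw [constantCoeff_C, map_zero] at h1
    exact PadicInt.prime_p.ne_zero h1
  · have h1 := h.map constantCoeff
    rw [constantCoeff_C] at h1
    exact PadicInt.prime_p.not_isUnit h1
  · rw [← PadicInt.map_residue_eq_zero_iff] at h ⊢
    rw [← PadicInt.map_residue_eq_zero_iff]
    rwa [map_mul, mul_eq_zero] at h

theorem PadicInt.exists_isDistinguishedAt_mul {g : ℤ_[p]⟦X⟧} (hg : ¬ C (p : ℤ_[p]) ∣ g) :
    ∃ (E : Polynomial ℤ_[p]) (v : ℤ_[p]⟦X⟧),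
      E.IsDistinguishedAt (IsLocalRing.maximalIdeal ℤ_[p]) ∧ IsUnit v ∧ g = E * v := by
  rw [← PadicInt.map_residue_eq_zero_iff] at hg
  obtain ⟨E, v, h⟩ := exists_isWeierstrassFactorization hg
  exact ⟨E, v, h.isDistinguishedAt, h.isUnit, h.eq_mul⟩

/-- A nonzero power series over `ℤ_p` has only finitely many zeros modulo a prime ideal not
containing `p`. -/
theorem PadicInt.exists_sub_mem_of_subst_mem {Q : Ideal ℤ_[p]⟦X⟧} [Q.IsPrime]
    (hpQ : C (p : ℤ_[p]) ∉ Q) {g : ℤ_[p]⟦X⟧} (hg : g ≠ 0) {h : ℕ → ℤ_[p]⟦X⟧}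
    (h0 : ∀ n, constantCoeff (h n) = 0) (hgh : ∀ n, g.subst (h n) ∈ Q) :
    ∃ i j, i < j ∧ h i - h j ∈ Q := by
  obtain ⟨g', hk, hg'⟩ := (FiniteMultiplicity.of_not_isUnit
    (PadicInt.prime_powerSeries_C (p := p)).not_isUnit hg).exists_eq_pow_mul_and_not_dvd
  generalize multiplicity (C (p : ℤ_[p])) g = k at hk
  subst hk
  obtain ⟨E, v, hE, hv, rfl⟩ := PadicInt.exists_isDistinguishedAt_mul hg'
  -- The powers of `p` and the unit factor avoid `Q`, so the zeros are roots of a monic polynomial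
  -- over a domain.
  let F := E.map (algebraMap ℤ_[p] (ℤ_[p]⟦X⟧ ⧸ Q))
  have hF : F ≠ 0 := (hE.monic.map _).ne_zero
  have hroot : ∀ n, Ideal.Quotient.mk Q (h n) ∈ F.rootSet (ℤ_[p]⟦X⟧ ⧸ Q) := fun n => by
    have hs := HasSubst.of_constantCoeff_zero' (h0 n)
    have h1 : (C (p : ℤ_[p]) ^ k * ((E : ℤ_[p]⟦X⟧) * v)).subst (h n) =
        C (p : ℤ_[p]) ^ k * (Polynomial.aeval (h n) E * v.subst (h n)) := by
      rw [subst_mul hs, subst_pow hs, subst_mul hs, subst_coe hs]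
      congr 2
      exact subst_C _
    have h2 := hgh n
    rw [h1] at h2
    have h3 : Polynomial.aeval (h n) E ∈ Q := by
      rcases Ideal.IsPrime.mem_or_mem inferInstance h2 with h3 | h3
      · exact absurd (Ideal.IsPrime.mem_of_pow_mem inferInstance _ h3) hpQ
      · refine (Ideal.IsPrime.mem_or_mem inferInstance h3).resolve_right fun h4 => ?_
        refine Ideal.IsPrime.ne_top (I := Q) inferInstance (Ideal.eq_top_of_isUnit_mem _ h4 ?_)
        rw [← coe_substAlgHom hs]
        exact hv.map _
    rw [Polynomial.mem_rootSet]
    refine ⟨hF, ?_⟩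
    rw [Polynomial.coe_aeval_eq_eval, Polynomial.eval_map_algebraMap,
      ← Ideal.Quotient.mkₐ_eq_mk ℤ_[p], Polynomial.aeval_algHom_apply, Ideal.Quotient.mkₐ_eq_mk,
      Ideal.Quotient.eq_zero_iff_mem]
    exact h3
  have hfin := F.rootSet_finite (ℤ_[p]⟦X⟧ ⧸ Q)
  obtain ⟨i, -, j, -, hij, he⟩ := Set.infinite_univ.exists_lt_map_eq_of_mapsTo
    (f := fun n => Ideal.Quotient.mk Q (h n)) (fun n _ => hroot n) hfin
  exact ⟨i, j, hij, Ideal.Quotient.eq.mp he⟩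

/-- A distinguished polynomial whose constant term is a uniformizer is Eisenstein. -/
theorem PadicInt.irreducible_of_isDistinguishedAt {E : Polynomial ℤ_[p]}
    (hE : E.IsDistinguishedAt (IsLocalRing.maximalIdeal ℤ_[p])) (h0 : Irreducible (E.coeff 0)) :
    Irreducible E := by
  have hm := h0.maximalIdeal_eq
  refine Polynomial.IsEisensteinAt.irreducible (𝓟 := IsLocalRing.maximalIdeal ℤ_[p])
    ⟨?_, hE.mem, ?_⟩ inferInstance hE.monic.isPrimitive (Nat.pos_of_ne_zero fun hd => ?_)
  · rw [hE.monic.leadingCoeff]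
    exact (Ideal.ne_top_iff_one _).mp (Ideal.IsPrime.ne_top inferInstance)
  · rw [hm, Ideal.span_singleton_pow, Ideal.mem_span_singleton]
    intro hdvd
    have := (pow_dvd_pow_iff h0.ne_zero h0.not_isUnit (n := 2) (m := 1)).mp (by rwa [pow_one])
    omega
  · rw [hE.monic.natDegree_eq_zero.mp hd, Polynomial.coeff_one_zero] at h0
    exact h0.not_isUnit isUnit_one

theorem PadicInt.injective_of_map_natCast_ne_zero {K : Type*} [Field K] {φ : ℤ_[p] →+* K}
    (hφ : φ (p : ℤ_[p]) ≠ 0) : Function.Injective φ := by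
  rw [injective_iff_map_eq_zero]
  intro x hx
  by_contra hx0
  rw [PadicInt.unitCoeff_spec hx0, map_mul, map_pow, mul_eq_zero] at hx
  rcases hx with hx | hx
  · exact ((PadicInt.unitCoeff hx0).isUnit.map φ).ne_zero hx
  · exact hφ (eq_zero_of_pow_eq_zero hx)

/-- As `p` is invertible in `K`, constants extend to `ℚ_p`. There `E` stays irreducible by Gauss's
lemma, hence is separable, and `π X` is a simple root. -/
theorem PadicInt.map_derivative_ne_zero {K : Type*} [Field K] {π : ℤ_[p]⟦X⟧ →+* K}
    (hπ : π (C (p : ℤ_[p])) ≠ 0) {E : Polynomial ℤ_[p]} (hE : E.Monic) (hEirr : Irreducible E)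
    (h : π (E : ℤ_[p]⟦X⟧) = 0) :
    π ((Polynomial.derivative E : Polynomial ℤ_[p]) : ℤ_[p]⟦X⟧) ≠ 0 := by
  have hφ : Function.Injective (π.comp C) := PadicInt.injective_of_map_natCast_ne_zero hπ
  obtain ⟨ψ, hψ⟩ : ∃ ψ : ℚ_[p] →+* K, ψ.comp (algebraMap ℤ_[p] ℚ_[p]) = π.comp C :=
    ⟨IsFractionRing.lift hφ, RingHom.ext fun x => IsFractionRing.lift_algebraMap hφ x⟩
  have heval : ∀ G : Polynomial ℤ_[p],
      (G.map (algebraMap ℤ_[p] ℚ_[p])).eval₂ ψ (π X) = π G := fun G => by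
    rw [Polynomial.eval₂_map, hψ, ← Polynomial.eval₂_C_X_eq_coe, Polynomial.hom_eval₂]
  have hsep := ((hE.irreducible_iff_irreducible_map_fraction_map
    (K := ℚ_[p])).mp hEirr).separable
  rw [← heval] at h ⊢
  rw [← Polynomial.derivative_map]
  exact hsep.eval₂_derivative_ne_zero ψ h

/-- A power series over `ℤ_p` whose constant term is a uniformizer has only simple zeros. -/
theorem PadicInt.C_mem_of_mem_of_derivative_mem {Q : Ideal ℤ_[p]⟦X⟧} [Q.IsPrime]
    {q : ℤ_[p]⟦X⟧} (hq : q ∈ Q) (hq' : derivative ℤ_[p] q ∈ Q)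
    (hirr : Irreducible (constantCoeff q)) : C (p : ℤ_[p]) ∈ Q := by
  have hunit : ∀ {v}, v ∈ Q → ¬ IsUnit v := fun hv hu =>
    Ideal.IsPrime.ne_top (I := Q) inferInstance (Ideal.eq_top_of_isUnit_mem _ hv hu)
  -- If `q = p r`, then `r(0)` is a unit, so `r` is a unit and `p ∈ Q`.
  by_cases hpq : C (p : ℤ_[p]) ∣ q
  · obtain ⟨r, rfl⟩ := hpq
    refine (Ideal.IsPrime.mem_or_mem inferInstance hq).resolve_right fun hr => hunit hr ?_
    rw [map_mul, constantCoeff_C] at hirr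
    exact isUnit_iff_constantCoeff.mpr
      ((hirr.isUnit_or_isUnit rfl).resolve_left PadicInt.prime_p.not_isUnit)
  obtain ⟨E, v, hE, hv, rfl⟩ := PadicInt.exists_isDistinguishedAt_mul hpq
  have hEQ : (E : ℤ_[p]⟦X⟧) ∈ Q :=
    (Ideal.IsPrime.mem_or_mem inferInstance hq).resolve_right fun h => hunit h hv
  have hEQ' : ((Polynomial.derivative E : Polynomial ℤ_[p]) : ℤ_[p]⟦X⟧) ∈ Q := by
    rw [Derivation.leibniz, smul_eq_mul, smul_eq_mul,
      Ideal.add_mem_iff_right _ (Ideal.mul_mem_right _ _ hEQ), derivative_coe] at hq'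
    exact (Ideal.IsPrime.mem_or_mem inferInstance hq').resolve_left fun h => hunit h hv
  have hE0 : Irreducible (E.coeff 0) := by
    rw [map_mul, ← coeff_zero_eq_constantCoeff_apply, Polynomial.coeff_coe] at hirr
    exact (irreducible_mul_isUnit (hv.map constantCoeff)).mp hirr
  have hEirr := PadicInt.irreducible_of_isDistinguishedAt hE hE0
  by_contra hpQ
  have hπ : ∀ g : ℤ_[p]⟦X⟧,
      ((algebraMap (ℤ_[p]⟦X⟧ ⧸ Q) (FractionRing (ℤ_[p]⟦X⟧ ⧸ Q))).comp (Ideal.Quotient.mk Q)) g = 0 ↔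
        g ∈ Q := fun g => by
    rw [← Ideal.Quotient.eq_zero_iff_mem, RingHom.comp_apply,
      map_eq_zero_iff _ (IsFractionRing.injective _ _)]
  exact PadicInt.map_derivative_ne_zero (fun h => hpQ ((hπ _).mp h)) hE.monic hEirr
    ((hπ _).mpr hEQ) ((hπ _).mpr hEQ')

end PadicInt

/-! ### The zeros of `f'` under iteration of `u` and `f`. -/

section Main

variable {p : ℕ} [Fact p.Prime]

theorem PadicInt.isUnit_of_dvd_C_pow {g : ℤ_[p]⟦X⟧} {n : ℕ} (hg : ¬ C (p : ℤ_[p]) ∣ g)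
    (h : g ∣ C (p : ℤ_[p]) ^ n) : IsUnit g := by
  obtain ⟨r, hr⟩ := h
  obtain ⟨s, rfl⟩ := PadicInt.prime_powerSeries_C.pow_dvd_of_dvd_mul_left n hg
    ⟨1, by rw [← hr, mul_one]⟩
  refine IsUnit.of_mul_eq_one s (mul_left_cancel₀
    (pow_ne_zero n (PadicInt.prime_powerSeries_C (p := p)).ne_zero) ?_)
  rw [mul_one, mul_left_comm, ← hr]

/-- The zeros of `f'` are permuted by an invertible series commuting with `f`. -/
theorem derivative_subst_compIter_mem {R : Type*} [CommRing R] {f u v : R⟦X⟧}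
    (hf : constantCoeff f = 0) (hu : constantCoeff u = 0) (hv : constantCoeff v = 0)
    (hcomm : f.subst u = u.subst f) (hvu : v.subst u = X) {Q : Ideal R⟦X⟧}
    (hQ : derivative R f ∈ Q) (n : ℕ) : (derivative R f).subst (compIter u n) ∈ Q := by
  have h := congrArg (derivative R) (subst_compIter_comm hf hu hcomm n)
  rw [derivative_subst (hasSubst_compIter hu n),
    derivative_subst (HasSubst.of_constantCoeff_zero' hf)] at h
  -- In the chain rule identity `h`, the derivative of the iterate of `u` is a unit and can be
  -- cancelled.
  have hunit := isUnit_derivative_of_subst_eq_X (constantCoeff_compIter hu n)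
    (compIter_subst_compIter hu hv hvu n)
  rw [← Ideal.mul_unit_mem_iff_mem Q hunit, h]
  exact Ideal.mul_mem_left _ _ hQ

/-- Apply the `i`-th iterate of `v` to both sides of the congruence. -/
theorem compIter_sub_X_mem {R : Type*} [CommRing R] {u v : R⟦X⟧}
    (hu : constantCoeff u = 0) (hv : constantCoeff v = 0) (hvu : v.subst u = X)
    {Q : Ideal R⟦X⟧} {i k : ℕ} (h : compIter u i - compIter u (i + k) ∈ Q) :
    compIter u k - X ∈ Q := by
  have hi := constantCoeff_compIter hu i
  have h1 := Q.mem_of_dvd (sub_dvd_subst_sub_subst hi (constantCoeff_compIter hu (i + k))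
    (compIter v i)) h
  rw [compIter_add hu, ← subst_comp_subst_apply (hasSubst_compIter hu i) (hasSubst_compIter hu k),
    compIter_subst_compIter hu hv hvu, subst_X (hasSubst_compIter hu k)] at h1
  rw [← neg_sub]
  exact Q.neg_mem h1

theorem isUnit_one_sub_of_not_isUnit {s : ℤ_[p]⟦X⟧} (hs : ¬ IsUnit (constantCoeff s)) :
    IsUnit (1 - s) :=
  (IsLocalRing.isUnit_or_isUnit_one_sub_self s).resolve_left fun h => hs (h.map constantCoeff)

/-- A zero of `w - X`, with `w ≠ X` commuting with `f`, is a zero of an iterate of `f`. -/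
theorem exists_compIter_mem {f w F : ℤ_[p]⟦X⟧} (hf : constantCoeff f = 0)
    (hw : constantCoeff w = 0) (hF : f = X * F) (hF0 : ¬ IsUnit (constantCoeff F))
    (hcomm : f.subst w = w.subst f) (hwX : w ≠ X)
    {Q : Ideal ℤ_[p]⟦X⟧} [Q.IsPrime] (hpQ : C (p : ℤ_[p]) ∉ Q) (hQ : w - X ∈ Q) :
    ∃ n, compIter f n ∈ Q := by
  -- Modulo `Q`, `w ∘ fⁿ = fⁿ ∘ w ≡ fⁿ`, where `fⁿ` is the iterate.
  have hroot : ∀ n, (w - X).subst (compIter f n) ∈ Q := fun n => by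
    have hn := hasSubst_compIter hf n
    have h := Q.mem_of_dvd
      (sub_dvd_subst_sub_subst hw (constantCoeff_X (R := ℤ_[p])) (compIter f n)) hQ
    rw [← subst_compIter_comm hw hf hcomm.symm n] at h
    rw [subst_sub hn, subst_X hn]
    convert h using 2
    exact (X_subst _).symm
  obtain ⟨i, j, hij, h⟩ := PadicInt.exists_sub_mem_of_subst_mem hpQ (sub_ne_zero.mpr hwX)
    (constantCoeff_compIter hf) hroot
  obtain ⟨k, rfl⟩ : ∃ k, j = i + k + 1 := ⟨j - i - 1, by omega⟩
  obtain ⟨s, hs, hd⟩ := exists_compIter_add_eq_mul hf hF i k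
  rw [hs, ← mul_one_sub, Ideal.mul_unit_mem_iff_mem Q
    (isUnit_one_sub_of_not_isUnit fun hu => hF0 (isUnit_of_dvd_unit hd hu))] at h
  exact ⟨i, h⟩

/-- A zero of an iterate of `f` is not a zero of `f'` if `f'(0)` is a uniformizer. -/
theorem C_mem_of_compIter_mem_of_derivative_mem {f : ℤ_[p]⟦X⟧} (hf : constantCoeff f = 0)
    (hirr : Irreducible (coeff 1 f)) {Q : Ideal ℤ_[p]⟦X⟧} [Q.IsPrime]
    (hQ : derivative ℤ_[p] f ∈ Q) {n : ℕ} (hn : compIter f n ∈ Q) : C (p : ℤ_[p]) ∈ Q := by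
  obtain ⟨F, hF⟩ := X_dvd_iff.mpr hf
  have hF0 : constantCoeff F = coeff 1 f := by
    rw [hF]
    simp
  induction n with
  | zero =>
    rw [compIter] at hn
    have hX : X ∣ derivative ℤ_[p] f - C (coeff 1 f) := by
      rw [X_dvd_iff, map_sub, constantCoeff_C, constantCoeff_derivative, sub_self]
    have ha : C (coeff 1 f) ∈ Q := by
      have h := Q.sub_mem hQ (Q.mem_of_dvd hX hn)
      rwa [sub_sub_cancel] at h
    exact Q.mem_of_dvd (map_dvd C (IsDiscreteValuationRing.associated_of_irreducible _ hirr
      PadicInt.irreducible_p).dvd) ha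
  | succ n ih =>
    by_cases hn' : compIter f n ∈ Q
    · exact ih hn'
    -- Splitting off the innermost `f` makes `f'` a factor of the derivative; splitting off the
    -- outermost one below gives the product to which Leibniz applies.
    have hd : derivative ℤ_[p] (compIter f (n + 1)) ∈ Q := by
      rw [compIter_add hf, compIter_one, derivative_subst (HasSubst.of_constantCoeff_zero' hf)]
      exact Ideal.mul_mem_left _ _ hQ
    rw [compIter_succ_eq_mul hf hF] at hn hd
    have hq := (Ideal.IsPrime.mem_or_mem inferInstance hn).resolve_left hn'
    rw [Derivation.leibniz, smul_eq_mul, smul_eq_mul,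
      Ideal.add_mem_iff_left _ (Ideal.mul_mem_right _ _ hq)] at hd
    refine PadicInt.C_mem_of_mem_of_derivative_mem hq
      ((Ideal.IsPrime.mem_or_mem inferInstance hd).resolve_left hn') ?_
    rwa [constantCoeff_subst_of_constantCoeff_zero (constantCoeff_compIter hf n), hF0]

/-- If `f'(0)` is a uniformizer, then `p` divides `f'`: otherwise `f'` has a zero, which is
fixed by an iterate of `u`, hence a zero of an iterate of `f`, hence not a zero of `f'`. The number
of zeros of `f` plays no role. -/
theorem C_dvd_derivative {f u : ℤ_[p]⟦X⟧} (hf : constantCoeff f = 0) (hu : constantCoeff u = 0)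
    (hcomm : f.subst u = u.subst f) (hu_inv : CompInvertible u) (hu_ord : CompInfiniteOrder u)
    (hirr : Irreducible (coeff 1 f)) : C (p : ℤ_[p]) ∣ derivative ℤ_[p] f := by
  by_contra hndvd
  obtain ⟨v, hv, -, hvu⟩ := hu_inv
  obtain ⟨F, hF⟩ := X_dvd_iff.mpr hf
  have hF0 : constantCoeff F = coeff 1 f := by
    rw [hF]
    simp
  have hdisj : Disjoint (Ideal.span {derivative ℤ_[p] f} : Set ℤ_[p]⟦X⟧)
      (Submonoid.powers (C (p : ℤ_[p]))) := by
    rw [Set.disjoint_left]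
    rintro _ h ⟨n, rfl⟩
    have h1 := (PadicInt.isUnit_of_dvd_C_pow hndvd (Ideal.mem_span_singleton.mp h)).map
      constantCoeff
    rw [constantCoeff_derivative] at h1
    exact hirr.not_isUnit h1
  obtain ⟨Q, hQ, hle, hQd⟩ := Ideal.exists_le_prime_disjoint _ _ hdisj
  have hpQ : C (p : ℤ_[p]) ∉ Q := fun h =>
    Set.disjoint_left.mp hQd h (Submonoid.mem_powers _)
  have hfQ : derivative ℤ_[p] f ∈ Q := hle (Ideal.mem_span_singleton_self _)
  have hne : derivative ℤ_[p] f ≠ 0 := fun h => hndvd (h ▸ dvd_zero _)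
  obtain ⟨i, j, hij, h⟩ := PadicInt.exists_sub_mem_of_subst_mem hpQ hne
    (constantCoeff_compIter hu) (derivative_subst_compIter_mem hf hu hv hcomm hvu hfQ)
  obtain ⟨k, rfl⟩ := Nat.exists_eq_add_of_lt hij
  rw [add_assoc] at h
  have hk := compIter_sub_X_mem hu hv hvu h
  obtain ⟨n, hn⟩ := exists_compIter_mem hf (constantCoeff_compIter hu _) hF
    (hF0 ▸ hirr.not_isUnit) (subst_compIter_comm hf hu hcomm _) (hu_ord _ k.succ_pos) hpQ hk
  exact hpQ (C_mem_of_compIter_mem_of_derivative_mem hf hirr hfQ hn)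

/-! ### Integrality of the derivative of the logarithm. -/

/-- If `f' = f'(0) g`, then `L' = (L' ∘ f) g` determines the coefficients of `L'` recursively, and
they are integral. -/
theorem exists_map_eq_of_subst_mul {R K : Type*} [CommRing R] [Field K] [Algebra R K]
    {φ g : R⟦X⟧} {M : K⟦X⟧} (hφ : constantCoeff φ = 0) (hg : constantCoeff g = 1)
    (hunit : ∀ n, 0 < n → IsUnit (1 - coeff 1 φ ^ n)) (hM : constantCoeff M = 1)
    (h : M = M.subst (φ.map (algebraMap R K)) * g.map (algebraMap R K)) :
    ∃ G : R⟦X⟧, M = G.map (algebraMap R K) := by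
  have hφ' : constantCoeff (φ.map (algebraMap R K)) = 0 := by
    rw [← coeff_zero_eq_constantCoeff_apply, coeff_map, coeff_zero_eq_constantCoeff_apply, hφ,
      map_zero]
  suffices hint : ∀ n, ∃ c : R, coeff n M = algebraMap R K c by
    choose G hG using hint
    exact ⟨PowerSeries.mk G, by ext n; rw [coeff_map, coeff_mk, hG]⟩
  intro n
  induction n using Nat.strong_induction_on with
  | _ n ih =>
    rcases Nat.eq_zero_or_pos n with rfl | hn
    · exact ⟨1, by rw [coeff_zero_eq_constantCoeff_apply, hM, map_one]⟩
    -- The part of `M ∘ φ` built from the coefficients already known to be integral.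
    let T : R⟦X⟧ := ∑ k : Fin n, C (ih k k.2).choose * φ ^ (k : ℕ)
    have hT : ∀ m, coeff m (T.map (algebraMap R K)) =
        ∑ k ∈ Finset.range n, coeff k M * coeff m (φ.map (algebraMap R K) ^ k) := fun m => by
      rw [← Fin.sum_univ_eq_sum_range
        (fun k => coeff k M * coeff m (φ.map (algebraMap R K) ^ k)) n]
      simp only [T, map_sum, map_mul, map_pow, map_C, coeff_C_mul]
      exact Finset.sum_congr rfl fun k _ => congrArg (· * _) (ih k k.2).choose_spec.symm
    have h1 := congrArg (coeff n) h
    have hsub : ∀ m ≤ n, coeff m (M.subst (φ.map (algebraMap R K))) =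
        coeff m (T.map (algebraMap R K)) +
          coeff n M * coeff m (φ.map (algebraMap R K) ^ n) := fun m hm => by
      rw [coeff_subst_eq_sum_of_lt hφ' M (Nat.lt_succ_of_le hm), Finset.sum_range_succ, hT]
    have h2 : coeff n M = coeff n ((T * g).map (algebraMap R K)) +
        coeff n M * algebraMap R K (coeff 1 φ ^ n) := by
      have h3 : coeff n (M.subst (φ.map (algebraMap R K)) * g.map (algebraMap R K)) =
          coeff n ((T.map (algebraMap R K) + C (coeff n M) * φ.map (algebraMap R K) ^ n) *
            g.map (algebraMap R K)) := by
        rw [coeff_mul, coeff_mul]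
        refine Finset.sum_congr rfl fun ij hij => ?_
        rw [Finset.HasAntidiagonal.mem_antidiagonal] at hij
        rw [hsub _ (by omega), map_add, coeff_C_mul]
      rw [h3, add_mul, map_add, ← map_mul (PowerSeries.map (algebraMap R K)), mul_assoc,
        coeff_C_mul, ← map_pow, ← map_mul (PowerSeries.map (algebraMap R K)),
        coeff_map (algebraMap R K) n (φ ^ n * g)] at h1
      rw [h1]
      -- The lowest term of `φ ^ n * g` has coefficient `(coeff 1 φ) ^ n`, because `g(0) = 1`.
      congr 3
      obtain ⟨ψ, rfl⟩ := X_dvd_iff.mpr hφ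
      simp [mul_pow, mul_assoc, coeff_X_pow_mul', hg]
    obtain ⟨r, hr⟩ := (hunit n hn).exists_right_inv
    refine ⟨coeff n (T * g) * r, ?_⟩
    have hr' := congrArg (algebraMap R K) hr
    rw [map_mul, map_sub, map_one] at hr'
    rw [coeff_map] at h2
    rw [map_mul]
    linear_combination (algebraMap R K r) * h2 - coeff n M * hr'

theorem lemma3p9 (p : ℕ) [Fact p.Prime] (f u : ℤ_[p]⟦X⟧)
    (hf0 : constantCoeff f = 0) (hu0 : constantCoeff u = 0)
    (hcomm : f.subst u = u.subst f)
    (hu_inv : CompInvertible u) (hu_ord : CompInfiniteOrder u)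
    (hf1 : (constantCoeff (derivative ℤ_[p] f)).valuation = 1)
    (hroots : (rootsInDisk p f).ncard = p) :
    ∃ g : ℤ_[p]⟦X⟧,
      derivative ℚ_[p] (lubinLog p f) = g.map (algebraMap ℤ_[p] ℚ_[p]) := by
  rw [constantCoeff_derivative] at hf1
  have ha : coeff 1 f ≠ 0 := fun h => by
    rw [h, PadicInt.valuation_zero] at hf1
    exact zero_ne_one hf1
  have hassoc : Associated (p : ℤ_[p]) (coeff 1 f) := by
    refine ⟨PadicInt.unitCoeff ha, ?_⟩
    conv_rhs => rw [PadicInt.unitCoeff_spec ha, hf1, pow_one, mul_comm]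
  have hirr : Irreducible (coeff 1 f) := hassoc.irreducible PadicInt.irreducible_p
  have hunit : ∀ n, 0 < n → IsUnit (1 - coeff 1 f ^ n) := fun n hn =>
    (IsLocalRing.isUnit_or_isUnit_one_sub_self (coeff 1 f ^ n)).resolve_left fun h =>
      hirr.not_isUnit ((isUnit_pow_iff hn.ne').mp h)
  -- Since `f'(0)` is not a root of unity, `lubinLog` is the true logarithm and not its default
  -- value `0`.
  have hL := isLubinLog_lubinLog p f hf0 ha fun n hn h => by
    have := hunit n hn
    rw [h, sub_self] at this
    exact not_isUnit_zero this
  obtain ⟨g, hg⟩ : C (coeff 1 f) ∣ derivative ℤ_[p] f :=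
    ((hassoc.map (C (R := ℤ_[p]))).dvd_iff_dvd_left).mp
      (C_dvd_derivative hf0 hu0 hcomm hu_inv hu_ord hirr)
  have hg1 : constantCoeff g = 1 := by
    have h := congrArg constantCoeff hg
    rw [constantCoeff_derivative, map_mul, constantCoeff_C] at h
    exact mul_left_cancel₀ ha (by rw [← h, mul_one])
  refine exists_map_eq_of_subst_mul hf0 hg1 hunit hL.deriv_zero ?_
  have hf0' : constantCoeff (f.map (algebraMap ℤ_[p] ℚ_[p])) = 0 := by
    rw [← coeff_zero_eq_constantCoeff_apply, coeff_map, coeff_zero_eq_constantCoeff_apply, hf0,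
      map_zero]
  have hd := congrArg (derivative ℚ_[p]) hL.subst_eq
  have hdf : derivative ℚ_[p] (f.map (algebraMap ℤ_[p] ℚ_[p])) =
      C ((coeff 1 f : ℤ_[p]) : ℚ_[p]) * g.map (algebraMap ℤ_[p] ℚ_[p]) := by
    have h := congrArg (PowerSeries.map (algebraMap ℤ_[p] ℚ_[p])) hg
    rw [map_mul, map_C] at h
    rw [← PadicInt.algebraMap_apply, ← h]
    ext n
    simp [coeff_derivative]
  rw [derivative_subst (HasSubst.of_constantCoeff_zero' hf0'), hdf, constantCoeff_derivative,
    Derivation.leibniz, derivative_C, smul_zero, add_zero, smul_eq_mul] at hd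
  refine mul_left_cancel₀ (a := C ((coeff 1 f : ℤ_[p]) : ℚ_[p])) ?_ ?_
  · rw [Ne, map_eq_zero_iff _ C_injective]
    exact fun h => ha (Subtype.ext h)
  · rw [← hd]
    ring

end Main
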